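/- Let $k$ be a field and let $f \in k[x_1,x_2,x_3,x_4]$ be a nonzero homogeneous polynomial of degree $3$ such that the cubic surface $V = \{f=0\} \subset \mathbf{P}^3_k$ is smooth over $k$. A line $\ell$ in $\mathbf{P}^3_k$ is a closed point of the Grassmannian $\operatorname{Gr}(4,2)$ of two-dimensional subspaces of $k^{\oplus 4}$, and its field of definition $L$ is the residue field of this closed point. The line $\ell$ corresponds to a two-dimensional subspace $S \subset L^{\oplus 4}$, and $\ell$ is contained in $V$ if the closed subscheme of $\mathbf{P}^3_L$ defined by the ideal generated by the linear forms vanishing on $S$ is contained in $V \otimes_k L$. Then for every line contained in $V$, the field of definition $L$ is a separable (algebraic) extension of $k$. -/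

import Mathlib

open CategoryTheory AlgebraicGeometry

universe u

namespace CubicLines

noncomputable section

/-! ### Closed subschemes of projective space given by homogeneous ideals -/

section QuotientGrading

variable {k A : Type u} [Field k] [CommRing A] [Algebra k A] (𝒜 : ℕ → Submodule k A)
  [GradedAlgebra 𝒜] (I : HomogeneousIdeal 𝒜)

/-- The degree `i` part of the quotient `A ⧸ I` of a graded algebra by a homogeneous ideal:
the image of the degree `i` part of `A`. -/
def quotientGrading (i : ℕ) : Submodule k (A ⧸ I.toIdeal) :=
  (𝒜 i).map (Ideal.Quotient.mkₐ k I.toIdeal).toLinearMap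

variable {𝒜} in
theorem mk_mem_quotientGrading {i : ℕ} {a : A} (ha : a ∈ 𝒜 i) :
    Ideal.Quotient.mk I.toIdeal a ∈ quotientGrading 𝒜 I i :=
  ⟨a, ha, rfl⟩

/-- The projection `𝒜 i → (A ⧸ I) i`. -/
def toQuotientGrading (i : ℕ) : 𝒜 i →+ quotientGrading 𝒜 I i where
  toFun a := ⟨Ideal.Quotient.mk I.toIdeal a.1, mk_mem_quotientGrading I a.2⟩
  map_zero' := by ext; simp
  map_add' a b := by ext; simp

/-- The decomposition of a class in `A ⧸ I` into homogeneous parts. -/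
def quotientDecompose : A ⧸ I.toIdeal →+ DirectSum ℕ fun i => quotientGrading 𝒜 I i :=
  QuotientAddGroup.lift I.toIdeal.toAddSubgroup
    ((DirectSum.map (toQuotientGrading 𝒜 I)).comp (DirectSum.decomposeAddEquiv 𝒜).toAddMonoidHom)
    (by
      intro a ha
      refine DFinsupp.ext fun i => Subtype.ext ?_
      exact Ideal.Quotient.eq_zero_iff_mem.mpr (I.isHomogeneous i ha))

theorem quotientDecompose_mk (a : A) :
    quotientDecompose 𝒜 I (Ideal.Quotient.mk I.toIdeal a) =
      DirectSum.map (toQuotientGrading 𝒜 I) (DirectSum.decompose 𝒜 a) :=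
  rfl

instance : SetLike.GradedMonoid (quotientGrading 𝒜 I) where
  one_mem := mk_mem_quotientGrading I (SetLike.GradedOne.one_mem (A := 𝒜))
  mul_mem := by
    rintro i j _ _ ⟨a, ha, rfl⟩ ⟨b, hb, rfl⟩
    exact ⟨a * b, SetLike.GradedMul.mul_mem ha hb, by simp⟩

/-- The quotient of a graded algebra by a homogeneous ideal is graded. -/
instance : GradedAlgebra (quotientGrading 𝒜 I) where
  toDecomposition := DirectSum.Decomposition.ofAddHom _ (quotientDecompose 𝒜 I)
    (by
      ext x
      obtain ⟨a, rfl⟩ := Ideal.Quotient.mk_surjective x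
      simp only [AddMonoidHom.comp_apply, AddMonoidHom.id_apply, quotientDecompose_mk]
      induction a using DirectSum.Decomposition.inductionOn 𝒜 with
      | zero => simp
      | homogeneous a =>
        rw [DirectSum.decompose_coe, DirectSum.map_of, DirectSum.coeAddMonoidHom_of]
        rfl
      | add a b ha hb => simp only [DirectSum.decompose_add, map_add, ha, hb])
    (by
      ext i x : 2
      obtain ⟨_, a, ha, rfl⟩ := x
      simp only [AddMonoidHom.comp_apply, AddMonoidHom.id_apply, DirectSum.coeAddMonoidHom_of]
      refine (quotientDecompose_mk 𝒜 I a).trans ?_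
      rw [DirectSum.decompose_of_mem 𝒜 ha, DirectSum.map_of]
      rfl)

end QuotientGrading

section Fractions

variable {k A : Type u} [Field k] [CommRing A] [Algebra k A] (𝒜 : ℕ → Submodule k A)
  [GradedAlgebra 𝒜]

instance (x : Proj 𝒜) : x.asHomogeneousIdeal.toIdeal.IsPrime :=
  ProjectiveSpectrum.isPrime x

/-- Evaluation at a point `x` of `Proj A` of the homogeneous fractions of degree zero whose
denominator does not vanish at `x`: the local ring at `x` is mapped to the residue field. -/
def evalAt (x : Proj 𝒜) :
    HomogeneousLocalization.AtPrime 𝒜 x.asHomogeneousIdeal.toIdeal →+* (Proj 𝒜).residueField x :=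
  ((Proj.stalkIso 𝒜 x).inv ≫ (Proj 𝒜).residue x).hom

/-- The value at a point `x` of `Proj A` of the fraction `a / b`, where `a` and `b` are
homogeneous of the same degree and `b` does not vanish at `x`. -/
def fractionAt (x : Proj 𝒜) {e : ℕ} {a b : A} (ha : a ∈ 𝒜 e) (hb : b ∈ 𝒜 e)
    (hx : x ∈ Proj.basicOpen 𝒜 b) : (Proj 𝒜).residueField x :=
  evalAt 𝒜 x (HomogeneousLocalization.mk
    { deg := e, num := ⟨a, ha⟩, den := ⟨b, hb⟩, den_mem := hx })

end Fractions

attribute [local instance] MvPolynomial.gradedAlgebra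

/-- The homogeneous ideal generated by one homogeneous polynomial. -/
def principalIdeal {k : Type u} [Field k] {σ : Type} (F : MvPolynomial σ k) {d : ℕ}
    (hF : F.IsHomogeneous d) : HomogeneousIdeal (MvPolynomial.homogeneousSubmodule σ k) where
  toSubmodule := Ideal.span {F}
  is_homogeneous' := by
    apply Ideal.homogeneous_span
    rintro _ rfl
    exact ⟨d, hF⟩

/-- The grading of the homogeneous coordinate ring `k[x_s : s ∈ σ] ⧸ (F)` by degree. -/
abbrev coordGrading {k : Type u} [Field k] {σ : Type} (F : MvPolynomial σ k) {d : ℕ}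
    (hF : F.IsHomogeneous d) :=
  quotientGrading (MvPolynomial.homogeneousSubmodule σ k) (principalIdeal F hF)

/-- The closed subscheme `{F = 0}` of the projective space over `k` with homogeneous
coordinates `x_s`, `s ∈ σ`: it is `Proj (k[x_s : s ∈ σ] ⧸ (F))`. -/
abbrev hypersurface {k : Type u} [Field k] {σ : Type} (F : MvPolynomial σ k) {d : ℕ}
    (hF : F.IsHomogeneous d) : Scheme.{u} :=
  Proj (coordGrading F hF)

/-- The structure morphism `{F = 0} ⟶ Spec k`. -/
def hypersurfaceToSpec {k : Type u} [Field k] {σ : Type} (F : MvPolynomial σ k) {d : ℕ}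
    (hF : F.IsHomogeneous d) : hypersurface F hF ⟶ Spec (.of k) :=
  Proj.toSpecZero (coordGrading F hF) ≫
    Spec.map (CommRingCat.ofHom (algebraMap k (coordGrading F hF 0)))

/-! ### The Grassmannian of lines in projective three-space -/

/-- Indices `(i, j)`, `i < j`, of the Plücker coordinates on `⋀² k⁴`. -/
abbrev PluckerIndex : Type := {s : Fin 4 × Fin 4 // s.1 < s.2}

/-- The Plücker coordinate `p i j` for arbitrary `i`, `j`: alternating in `i` and `j`. -/
def plucker (k : Type u) [Field k] (i j : Fin 4) : MvPolynomial PluckerIndex k :=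
  if h : i < j then MvPolynomial.X ⟨(i, j), h⟩
  else if h : j < i then -MvPolynomial.X ⟨(j, i), h⟩
  else 0

theorem plucker_isHomogeneous (k : Type u) [Field k] (i j : Fin 4) :
    (plucker k i j).IsHomogeneous 1 := by
  unfold plucker
  split_ifs
  · exact MvPolynomial.isHomogeneous_X _ _
  · exact (MvPolynomial.isHomogeneous_X _ _).neg
  · exact MvPolynomial.isHomogeneous_zero _ _ _

/-- The Plücker relation: a vector of `⋀² k⁴` is decomposable if and only if it satisfies it. -/
def pluckerRelation (k : Type u) [Field k] : MvPolynomial PluckerIndex k :=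
  plucker k 0 1 * plucker k 2 3 - plucker k 0 2 * plucker k 1 3 + plucker k 0 3 * plucker k 1 2

theorem pluckerRelation_isHomogeneous (k : Type u) [Field k] :
    (pluckerRelation k).IsHomogeneous 2 :=
  ((((plucker_isHomogeneous k 0 1).mul (plucker_isHomogeneous k 2 3)).sub
    ((plucker_isHomogeneous k 0 2).mul (plucker_isHomogeneous k 1 3))).add
    ((plucker_isHomogeneous k 0 3).mul (plucker_isHomogeneous k 1 2)))

/-- The Grassmannian `Gr(4, 2)` of two-dimensional subspaces of `k⁴`, as the Plücker quadric
in `ℙ(⋀² k⁴) = ℙ⁵`. -/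
abbrev Gr (k : Type u) [Field k] : Scheme.{u} :=
  hypersurface (pluckerRelation k) (pluckerRelation_isHomogeneous k)

/-- The structure morphism `Gr(4, 2) ⟶ Spec k`. -/
abbrev grToSpec (k : Type u) [Field k] : Gr k ⟶ Spec (.of k) :=
  hypersurfaceToSpec (pluckerRelation k) (pluckerRelation_isHomogeneous k)

/-- A line in `ℙ³` over `k`: a closed point of `Gr(4, 2)`. -/
structure Line (k : Type u) [Field k] where
  point : Gr k
  isClosed_point : IsClosed {point}

namespace Line

variable {k : Type u} [Field k] (ℓ : Line k)

/-- The field of definition of a line: the residue field of the closed point. -/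
abbrev fieldOfDefinition : Type u := (Gr k).residueField ℓ.point

/-- The residue field is an extension of `k` through the structure morphism
`Gr(4, 2) ⟶ Spec k`. -/
instance : Algebra k ℓ.fieldOfDefinition :=
  ((Scheme.ΓSpecIso (.of k)).inv ≫ (grToSpec k).appTop ≫
    (Gr k).Γevaluation ℓ.point).hom.toAlgebra

/-- `ℓ` lies in the chart where the Plücker coordinate `p a b` does not vanish. -/
def InChart (a b : Fin 4) : Prop :=
  ℓ.point ∈ Proj.basicOpen (coordGrading (pluckerRelation k) (pluckerRelation_isHomogeneous k))
    (Ideal.Quotient.mk _ (plucker k a b))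

/-- The value at `ℓ` of the quotient of Plücker coordinates `p i j / p a b`. -/
def ratio {a b : Fin 4} (h : ℓ.InChart a b) (i j : Fin 4) : ℓ.fieldOfDefinition :=
  fractionAt (coordGrading (pluckerRelation k) (pluckerRelation_isHomogeneous k)) ℓ.point
    (mk_mem_quotientGrading _ (plucker_isHomogeneous k i j))
    (mk_mem_quotientGrading _ (plucker_isHomogeneous k a b)) h

/-- The two-dimensional subspace `S` of `L⁴` that corresponds to `ℓ`, where `L` is the field of
definition: the fibre at `ℓ` of the tautological bundle. It consists of the vectors `v` with
`ω ∧ v = 0` in `⋀³ L⁴`, where `ω ∈ ⋀² L⁴` is the vector (unique up to scaling) with the Plücker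
coordinates of `ℓ`; the condition does not depend on the chart in which `ω` is normalized. -/
def subspace : Submodule ℓ.fieldOfDefinition (Fin 4 → ℓ.fieldOfDefinition) where
  carrier := {v | ∀ (a b : Fin 4) (h : ℓ.InChart a b) (i j m : Fin 4),
    ℓ.ratio h i j * v m - ℓ.ratio h i m * v j + ℓ.ratio h j m * v i = 0}
  zero_mem' := by
    intro a b h i j m
    simp
  add_mem' := by
    intro v w hv hw a b h i j m
    have h1 := hv a b h i j m
    have h2 := hw a b h i j m
    simp only [Pi.add_apply]
    linear_combination h1 + h2
  smul_mem' := by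
    intro c v hv a b h i j m
    have h1 := hv a b h i j m
    simp only [Pi.smul_apply, smul_eq_mul]
    linear_combination c * h1

/-- The homogeneous ideal of `ℓ` as a closed subscheme of `ℙ³` over its field of definition `L`:
the ideal of `L[x₀, x₁, x₂, x₃]` generated by the linear forms that vanish on the subspace. -/
def ideal : Ideal (MvPolynomial (Fin 4) ℓ.fieldOfDefinition) :=
  Ideal.span {φ | ∃ c : Fin 4 → ℓ.fieldOfDefinition,
    (∀ v ∈ ℓ.subspace, ∑ i, c i * v i = 0) ∧ φ = ∑ i, MvPolynomial.C (c i) * MvPolynomial.X i}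

/-- `ℓ` is contained in the surface `{f = 0}`, i.e. `ℓ ⊂ {f = 0} ⊗ L` as closed subschemes of
`ℙ³` over the field of definition `L`: the equation `f` lies in the homogeneous ideal of `ℓ`
(an ideal generated by linear forms, hence saturated). -/
def IsContainedIn (f : MvPolynomial (Fin 4) k) : Prop :=
  MvPolynomial.map (algebraMap k ℓ.fieldOfDefinition) f ∈ ℓ.ideal

end Line

end

end CubicLines

/-! A line on a smooth cubic surface is infinitesimally rigid: its normal bundle in $V$ has degree
$-1$, hence no nonzero sections. Rigidity over $k$ forces every $k$-derivation $D$ of the field of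
definition $L$ to vanish. As $L$ is finitely generated over $k$, this gives $\Omega_{L/k}=0$ and
hence separability (`isSeparable_of_forall_derivation_eq_zero`).

The rigidity is made explicit in `derivation_eq_zero_of_mem_linearIdeal`. Normalize a basis $u,w$ of
the line so that two coordinates form an identity matrix. Applying $D$ to $f(u+Tw)=0$ in $L[T]$
leaves $l_2q_2+l_3q_3=0$, where the $q_i$ are the two remaining partial derivatives of $f$ along the
line (binary quadratic forms) and the $l_i$ are linear with coefficients $D(u_i),D(w_i)$. A common
zero of $q_2,q_3$ would be a singular point of $V$, since the derivatives of $f$ along the line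
vanish anyway. So the $q_i$ are coprime, and comparing degrees gives $l_2=l_3=0$
(`linear_relation_eq_zero`). All Plücker ratios are minors of $(u,w)$ and generate $L$, so $D=0$.

Scheme-theoretic smoothness enters only through `exists_aeval_pderiv_ne_zero_of_smooth`, a Jacobian
criterion deduced from infinitesimal lifting without dimension theory. -/

namespace CubicLines

/-! ### Taylor expansion, chain rule, and the affine Jacobian criterion -/

section PolynomialAlgebra

open MvPolynomial

variable {k σ : Type*} [CommRing k]

/-- First order Taylor expansion of a polynomial modulo the square of an ideal. -/
theorem aeval_add_sub_mem_sq [Fintype σ] {B : Type*} [CommRing B] [Algebra k B] (I : Ideal B)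
    (v h : σ → B) (hh : ∀ i, h i ∈ I) (f : MvPolynomial σ k) :
    aeval (v + h) f - (aeval v f + ∑ i, h i * aeval v (pderiv i f)) ∈ I ^ 2 := by
  classical
  induction f using MvPolynomial.induction_on with
  | C a => simp
  | add p q hp hq =>
    convert! add_mem hp hq using 1
    simp only [map_add, mul_add, Finset.sum_add_distrib]
    ring
  | mul_X p j hp =>
    have hsum : ∑ i, h i * aeval v (pderiv i p) ∈ I :=
      sum_mem fun i _ => Ideal.mul_mem_right _ _ (hh i)
    have h1 : ∑ i, h i * aeval v (pderiv i (p * X j)) =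
        (∑ i, h i * aeval v (pderiv i p)) * v j + h j * aeval v p := by
      simp only [pderiv_mul, pderiv_X, map_add, map_mul, aeval_X, mul_add, Finset.sum_add_distrib,
        Finset.sum_mul, mul_assoc, Pi.single_apply]
      simp [apply_ite]
    rw [h1]
    have h2 := add_mem (Ideal.mul_mem_right (v j + h j) _ hp)
      (pow_two I ▸ Ideal.mul_mem_mul hsum (hh j))
    convert! h2 using 1
    simp only [map_mul, aeval_X, Pi.add_apply]
    ring

theorem _root_.MvPolynomial.IsHomogeneous.aeval_mul_left {f : MvPolynomial σ k} {n : ℕ}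
    (hf : f.IsHomogeneous n) {B : Type*} [CommRing B] [Algebra k B] (c : B) (v : σ → B) :
    aeval (fun i => c * v i) f = c ^ n * aeval v f := by
  rw [aeval_def, eval₂_eq, aeval_def, eval₂_eq, Finset.mul_sum]
  refine Finset.sum_congr rfl fun d hd => ?_
  have hn : ∑ i ∈ d.support, d i = n := by
    rw [← Finsupp.degree_apply, Finsupp.degree_eq_weight_one]
    exact hf (mem_support_iff.mp hd)
  rw [← hn, ← Finset.prod_pow_eq_pow_sum]
  simp only [mul_pow, Finset.prod_mul_distrib]
  ring

theorem _root_.Derivation.map_mvPolynomial_aeval [Fintype σ] {B M : Type*} [CommRing B]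
    [Algebra k B] [AddCommGroup M] [Module B M] [Module k M] (d : Derivation k B M)
    (v : σ → B) (f : MvPolynomial σ k) :
    d (aeval v f) = ∑ i, aeval v (pderiv i f) • d (v i) := by
  classical
  induction f using MvPolynomial.induction_on with
  | C a => simp
  | add p q hp hq => simp only [map_add, hp, hq, add_smul, Finset.sum_add_distrib]
  | mul_X p j hp =>
    simp only [map_mul, aeval_X, Derivation.leibniz, hp, pderiv_X, map_add, add_smul,
      Finset.sum_add_distrib, Finset.smul_sum, Pi.single_apply, apply_ite, smul_comm (v j)]
    simp [smul_smul, mul_comm]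

theorem aeval_aeval_update [DecidableEq σ] {B : Type*} [CommRing B] [Algebra k B] (i : σ)
    (z : σ → B) (hz : z i = 1) (p : MvPolynomial σ k) :
    aeval z (aeval (Function.update (X : σ → MvPolynomial σ k) i 1) p) = aeval z p := by
  rw [comp_aeval_apply]
  congr 2
  funext j
  by_cases hj : j = i
  · subst hj; simp [hz]
  · simp [Function.update_of_ne hj]

/-- The Jacobian criterion on the chart `x i = 1`: if `A` is formally smooth over `k` and has
`k[x] ⧸ (f, x i - 1)` as a retract, then `f` has no singular point `z` with `z i = 1`. -/
theorem exists_aeval_pderiv_ne_zero {k : Type*} [Field k] [Fintype σ] [DecidableEq σ]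
    {f : MvPolynomial σ k} {n : ℕ}
    (hf : f.IsHomogeneous n) (hf0 : f ≠ 0) (i : σ) {A : Type*} [CommRing A] [Algebra k A]
    [Algebra.FormallySmooth k A] (y : σ → A) (hy : aeval y f = 0)
    (I : Ideal (MvPolynomial σ k)) (hI : I = Ideal.span {f, X i - 1})
    (ρ : A →ₐ[k] MvPolynomial σ k ⧸ I)
    (hρ : ∀ j, ρ (y j) = Ideal.Quotient.mk _ (X j))
    {K : Type*} [Field K] [Algebra k K] (z : σ → K) (hz : z i = 1) (hfz : aeval z f = 0) :
    ∃ j, aeval z (pderiv j f) ≠ 0 := by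
  by_contra! hsing
  set M : Ideal (MvPolynomial σ k) := RingHom.ker (aeval z : MvPolynomial σ k →ₐ[k] K) with hM
  have hIM : I ≤ M := by
    rw [hI, Ideal.span_le]
    rintro _ (rfl | rfl)
    · exact hfz
    · simp [hM, hz]
  -- `M` is the ideal of the point `z`. Working modulo `M * I` keeps the kernel of `Q` square-zero,
  -- yet still detects whether `f` vanishes to first order at `z`.
  have hJ : I ^ 2 ≤ M * I := by rw [pow_two]; exact Ideal.mul_mono_left hIM
  have hMI : M * I ≤ I := Ideal.mul_le_right
  -- lift `ρ` modulo `M * I`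
  set Q : MvPolynomial σ k ⧸ M * I →ₐ[k] MvPolynomial σ k ⧸ I := Ideal.Quotient.factorₐ k hMI
  have hker : IsNilpotent (RingHom.ker (Q : MvPolynomial σ k ⧸ M * I →+* MvPolynomial σ k ⧸ I)) := by
    have key (N : Ideal (MvPolynomial σ k ⧸ M * I)) (h : N * N ≤ ⊥) : IsNilpotent N :=
      ⟨2, (pow_two N).trans (le_bot_iff.mp h)⟩
    refine key _ ?_
    rw [Ideal.mul_le]
    intro r hr s hs
    obtain ⟨r, rfl⟩ := Ideal.Quotient.mk_surjective r
    obtain ⟨s, rfl⟩ := Ideal.Quotient.mk_surjective s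
    have hr' : r ∈ I := Ideal.Quotient.eq_zero_iff_mem.mp hr
    have hs' : s ∈ I := Ideal.Quotient.eq_zero_iff_mem.mp hs
    rw [← map_mul]
    exact Ideal.Quotient.eq_zero_iff_mem.mpr (hJ (pow_two I ▸ Ideal.mul_mem_mul hr' hs'))
  obtain ⟨τ, hτ⟩ : ∃ τ : A →ₐ[k] MvPolynomial σ k ⧸ M * I, Q.comp τ = ρ :=
    ⟨Algebra.FormallySmooth.liftOfSurjective ρ Q (Ideal.Quotient.factor_surjective hMI) hker,
      AlgHom.ext fun a => Algebra.FormallySmooth.liftOfSurjective_apply ρ Q _ hker a⟩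
  have hlift : ∀ j, ∃ h ∈ I, τ (y j) = Ideal.Quotient.mk _ (X j + h) := by
    intro j
    obtain ⟨p, hp⟩ := Ideal.Quotient.mk_surjective (τ (y j))
    refine ⟨p - X j, ?_, by rw [← hp]; congr 1; ring⟩
    have h1 : Q (τ (y j)) = Ideal.Quotient.mk _ (X j) := by rw [← hρ, ← hτ]; rfl
    rw [← hp] at h1
    exact Ideal.Quotient.eq.mp h1
  choose h hhI hh using hlift
  have hfh : aeval (X + h : σ → MvPolynomial σ k) f ∈ M * I := by
    rw [← Ideal.Quotient.eq_zero_iff_mem, ← Ideal.Quotient.mkₐ_eq_mk k, comp_aeval_apply]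
    have : (fun j => Ideal.Quotient.mkₐ k (M * I) ((X + h : σ → MvPolynomial σ k) j)) = fun j => τ (y j) := by
      funext j; rw [hh]; rfl
    rw [this, ← comp_aeval_apply, hy, map_zero]
  -- In the Taylor expansion of `f (X + h)` the remainder lies in `I ^ 2`, and the linear terms lie
  -- in `M * I` because all partial derivatives vanish at `z`. Hence `f` itself lies in `M * I`.
  have hfMI : f ∈ M * I := by
    have h1 := hJ (aeval_add_sub_mem_sq I (X : σ → MvPolynomial σ k) h hhI f)
    have h2 : ∑ j, h j * aeval (X : σ → MvPolynomial σ k) (pderiv j f) ∈ M * I :=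
      sum_mem fun j _ => by
        rw [mul_comm (h j), aeval_X_left_apply]
        exact Ideal.mul_mem_mul (show pderiv j f ∈ M from hsing j) (hhI j)
    rw [aeval_X_left_apply] at h1
    have h3 := sub_mem (sub_mem hfh h1) h2
    convert! h3 using 1
    ring
  -- specialize `x i = 1`
  set ψ : MvPolynomial σ k →ₐ[k] MvPolynomial σ k := aeval (Function.update X i 1) with hψ
  have hzψ : ∀ p, aeval z (ψ p) = aeval z p := aeval_aeval_update i z hz
  -- A form is recovered from its dehomogenization: in the fraction field, `f` is `x i ^ n` times `ψ
  -- f` evaluated at `x / x i`.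
  have hψf : ψ f ≠ 0 := by
    intro h0
    apply hf0
    let F := FractionRing (MvPolynomial σ k)
    let x : σ → F := fun j => algebraMap (MvPolynomial σ k) F (X j)
    have hinj : Function.Injective (algebraMap (MvPolynomial σ k) F) := IsFractionRing.injective _ _
    have hxi : x i ≠ 0 := by
      intro h
      exact X_ne_zero i ((map_eq_zero_iff _ hinj).mp h)
    have h1 : aeval x f = x i ^ n * aeval (fun j => (x i)⁻¹ * x j) f := by
      rw [← hf.aeval_mul_left]
      congr 2
      funext j
      rw [mul_inv_cancel_left₀ hxi]
    have h2 : aeval (fun j => (x i)⁻¹ * x j) (ψ f) = aeval (fun j => (x i)⁻¹ * x j) f :=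
      aeval_aeval_update i _ (inv_mul_cancel₀ hxi) f
    rw [← h2, h0, map_zero, mul_zero] at h1
    rw [← map_eq_zero_iff _ hinj, ← h1]
    have h3 := aeval_algebraMap_apply F (X : σ → MvPolynomial σ k) f
    rw [aeval_X_left_apply] at h3
    exact h3.symm
  -- `ψ` kills `X i - 1`, so it sends `I` into the principal ideal of `ψ f`; it preserves `M`
  -- because `z i = 1`. Cancelling `ψ f` then forces `m = 1`, although `m` vanishes at `z`.
  obtain ⟨m, hm, hfm⟩ : ∃ m ∈ M, ψ f = m * ψ f := by
    have hle : M * I ≤ Ideal.comap ψ (Ideal.map ψ M * Ideal.span {ψ f}) := by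
      rw [Ideal.mul_le]
      intro r hr s hs
      rw [Ideal.mem_comap, map_mul]
      refine Ideal.mul_mem_mul (Ideal.mem_map_of_mem _ hr) ?_
      have : I ≤ Ideal.comap ψ (Ideal.span {ψ f}) := by
        rw [hI, Ideal.span_le]
        rintro _ (rfl | rfl)
        · exact Ideal.mem_span_singleton_self _
        · simp [hψ]
      exact this hs
    obtain ⟨c, hc, hcf⟩ := Ideal.mem_mul_span_singleton.mp (hle hfMI)
    refine ⟨c, ?_, ?_⟩
    · have : Ideal.map ψ M ≤ M := by
        rw [Ideal.map_le_iff_le_comap]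
        intro p hp
        rw [Ideal.mem_comap, hM, RingHom.mem_ker, hzψ]
        exact hp
      exact this hc
    · exact hcf.symm
  have h1 : m = 1 := by
    have : (m - 1) * ψ f = 0 := by rw [sub_mul, ← hfm, one_mul, sub_self]
    exact sub_eq_zero.mp ((mul_eq_zero.mp this).resolve_right hψf)
  have h2 : aeval z m = 0 := hm
  rw [h1, map_one] at h2
  exact one_ne_zero h2

end PolynomialAlgebra

/-! ### Charts and residue fields of `Proj` over the base field -/

noncomputable section

attribute [local instance] MvPolynomial.gradedAlgebra

/-- `Proj.toSpecZero` passes through the basic open of `1`, equal to `⊤` only propositionally; this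
removes the resulting transport from germs. -/
theorem topIso_inv_comp_germ (X : Scheme.{u}) (U : X.Opens) (hU : U = ⊤) (x : X) :
    U.topIso.inv ≫ (X.isoOfEq hU).inv.appTop ≫ X.topIso.inv.appTop ≫
      X.presheaf.germ ⊤ x trivial = X.presheaf.germ U x (hU ▸ trivial) := by
  subst hU
  have h1 : (X.isoOfEq (rfl : (⊤ : X.Opens) = ⊤)).inv = 𝟙 _ := by
    rw [← cancel_mono (Scheme.Opens.ι _)]; simp
  have h2 : (⊤ : X.Opens).ι.appTop ≫ X.topIso.inv.appTop = 𝟙 _ := by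
    rw [← Scheme.Hom.comp_appTop, Scheme.toIso_inv_ι, Scheme.Hom.id_appTop]
  have h3 : (⊤ : X.Opens).topIso.inv = (⊤ : X.Opens).ι.appTop := by
    rw [Scheme.Opens.topIso_inv, Scheme.Opens.ι_appTop]
    rfl
  rw [h1, h3, Scheme.Hom.id_appTop, Category.id_comp, reassoc_of% h2]

section Projective
variable {k A : Type u} [Field k] [CommRing A] [Algebra k A] (𝒜 : ℕ → Submodule k A)
  [GradedAlgebra 𝒜]

theorem smooth_away {s : A} {m : ℕ} (hs : s ∈ 𝒜 m) (hm : 0 < m)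
    [Smooth (Proj.toSpecZero 𝒜 ≫ Spec.map (CommRingCat.ofHom (algebraMap k (𝒜 0))))] :
    ((HomogeneousLocalization.fromZeroRingHom 𝒜 (Submonoid.powers s)).comp
      (algebraMap k (𝒜 0))).Smooth := by
  have h : Smooth (Proj.awayι 𝒜 s hs hm ≫ Proj.toSpecZero 𝒜 ≫
      Spec.map (CommRingCat.ofHom (algebraMap k (𝒜 0)))) := inferInstance
  rw [Proj.awayι_toSpecZero_assoc, ← Spec.map_comp,
    HasRingHomProperty.Spec_iff (P := @Smooth)] at h
  exact h

/-- Makes the algebra structure of a residue field computable: a scalar acts as the value of a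
constant fraction of degree zero. -/
theorem toSpecZero_Γevaluation (x : Proj 𝒜) :
    (Scheme.ΓSpecIso (.of k)).inv ≫ (Proj.toSpecZero 𝒜 ≫
      Spec.map (CommRingCat.ofHom (algebraMap k (𝒜 0)))).appTop ≫ (Proj 𝒜).Γevaluation x =
    CommRingCat.ofHom ((evalAt 𝒜 x).comp
      ((HomogeneousLocalization.fromZeroRingHom 𝒜 _).comp (algebraMap k (𝒜 0)))) := by
  rw [Scheme.Hom.comp_appTop, Category.assoc, ← Scheme.ΓSpecIso_inv_naturality_assoc]
  have h : (Scheme.ΓSpecIso (.of (𝒜 0))).inv ≫ (Proj.toSpecZero 𝒜).appTop ≫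
      (Proj 𝒜).presheaf.germ ⊤ x trivial =
      CommRingCat.ofHom (HomogeneousLocalization.fromZeroRingHom 𝒜 _) ≫ (Proj.stalkIso 𝒜 x).inv := by
    simp only [Proj.toSpecZero, Scheme.Hom.comp_appTop, Category.assoc]
    rw [Proj.basicOpenToSpec]
    simp only [Scheme.Hom.comp_appTop, Category.assoc]
    rw [← Scheme.ΓSpecIso_inv_naturality_assoc]
    rw [← Scheme.ΓSpecIso_inv_naturality_assoc]
    rw [Scheme.Opens.toSpecΓ_appTop]
    simp only [Category.assoc, Iso.inv_hom_id_assoc]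
    erw [topIso_inv_comp_germ _ _ (Proj.basicOpen_one 𝒜)]
    have hx : x ∈ Proj.basicOpen 𝒜 1 := by rw [Proj.basicOpen_one]; trivial
    have h1 := ProjectiveSpectrum.Proj.awayToSection_germ 𝒜 1 x hx
    have h2 := congr(CommRingCat.ofHom (HomogeneousLocalization.fromZeroRingHom 𝒜 _) ≫ $h1)
    refine h2.trans ?_
    rw [← Category.assoc, ← CommRingCat.ofHom_comp]
    rfl
  have h' := congr(CommRingCat.ofHom (algebraMap k (𝒜 0)) ≫ $h ≫ (Proj 𝒜).residue x)
  simp only [Category.assoc] at h'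
  exact h'

end Projective

/-! ### The Jacobian criterion for projective hypersurfaces -/

section Jacobian

open MvPolynomial

/-- A smooth hypersurface has no geometric point at which all partial derivatives vanish. -/
theorem exists_aeval_pderiv_ne_zero_of_smooth {k : Type u} [Field k] {σ : Type} [Fintype σ]
    [DecidableEq σ] {f : MvPolynomial σ k} {n : ℕ} (hf : f.IsHomogeneous n) (hf0 : f ≠ 0)
    (hsm : Smooth (hypersurfaceToSpec f hf)) {K : Type*} [Field K] [Algebra k K]
    (z : σ → K) (hz : z ≠ 0) (hfz : aeval z f = 0) :
    ∃ j, aeval z (pderiv j f) ≠ 0 := by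
  obtain ⟨i, hi⟩ : ∃ i, z i ≠ 0 := Function.ne_iff.mp hz
  let J := (principalIdeal f hf).toIdeal
  let s : MvPolynomial σ k ⧸ J := Ideal.Quotient.mk J (X i)
  have hmem (j : σ) : Ideal.Quotient.mk J (X j) ∈ coordGrading f hf 1 :=
    mk_mem_quotientGrading _ (isHomogeneous_X k j)
  have hs : s ∈ coordGrading f hf 1 := hmem i
  let W := HomogeneousLocalization.Away (coordGrading f hf) s
  let _ : Algebra k W := ((HomogeneousLocalization.fromZeroRingHom (coordGrading f hf)
    (Submonoid.powers s)).comp (algebraMap k (coordGrading f hf 0))).toAlgebra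
  have : Algebra.FormallySmooth k W := by
    have : Smooth (Proj.toSpecZero (coordGrading f hf) ≫
      Spec.map (CommRingCat.ofHom (algebraMap k (coordGrading f hf 0)))) := hsm
    exact (smooth_away (coordGrading f hf) hs one_pos).1
  let val : W →ₐ[k] Localization.Away s :=
    { algebraMap W (Localization.Away s) with
      commutes' := fun c => by
        change HomogeneousLocalization.val (HomogeneousLocalization.mk _) = _
        rw [HomogeneousLocalization.val_mk]
        exact Localization.mk_one_eq_algebraMap _ }
  have val_inj : Function.Injective val := HomogeneousLocalization.val_injective _
  let y : σ → W := fun j =>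
    HomogeneousLocalization.Away.mk (coordGrading f hf) hs 1 (Ideal.Quotient.mk J (X j))
      (by simpa using hmem j)
  let ξ : σ → Localization.Away s := fun j => algebraMap _ _ (Ideal.Quotient.mk J (X j))
  have hval (j : σ) : val (y j) = IsLocalization.Away.invSelf s * ξ j := by
    change HomogeneousLocalization.val (HomogeneousLocalization.Away.mk _ hs 1 _ _) = _
    rw [HomogeneousLocalization.Away.val_mk, Localization.mk_eq_mk',
      IsLocalization.mk'_eq_iff_eq_mul, mul_right_comm]
    have h := IsLocalization.Away.mul_invSelf (S := Localization.Away s) s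
    simp only [pow_one]
    change ξ j = _
    rw [mul_comm (IsLocalization.Away.invSelf s), h, one_mul]
  have hy : aeval y f = 0 := by
    apply val_inj
    rw [comp_aeval_apply, map_zero]
    simp only [hval]
    rw [hf.aeval_mul_left]
    have : aeval ξ f = 0 := by
      have h1 : aeval ξ f = (Algebra.ofId _ (Localization.Away s)).restrictScalars k
          (Ideal.Quotient.mkₐ k J (aeval X f)) := by
        rw [comp_aeval_apply, comp_aeval_apply]; rfl
      have h2 : Ideal.Quotient.mkₐ k J f = 0 :=
        Ideal.Quotient.eq_zero_iff_mem.mpr (Ideal.mem_span_singleton_self f)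
      rw [h1, aeval_X_left_apply, h2, map_zero]
    rw [this, mul_zero]
  let I : Ideal (MvPolynomial σ k) := Ideal.span {f, X i - 1}
  have hJI : J ≤ I := Ideal.span_mono (by simp)
  have hunit : Ideal.Quotient.mk I (X i) = 1 := by
    rw [← map_one (Ideal.Quotient.mk I)]
    exact Ideal.Quotient.eq.mpr (Ideal.subset_span (by simp))
  -- Setting `X i = 1` makes `s` invertible, which maps the chart ring to `k[x] ⧸ (f, X i - 1)`. No
  -- inverse of this map is needed.
  let lift : Localization.Away s →+* MvPolynomial σ k ⧸ I :=
    Localization.awayLift (Ideal.Quotient.factor hJI) s (by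
      simp only [s, Ideal.Quotient.factor_mk, hunit, isUnit_one])
  have lift_algebraMap (a : MvPolynomial σ k) :
      lift (algebraMap _ _ (Ideal.Quotient.mk J a)) = Ideal.Quotient.mk I a := by
    exact IsLocalization.Away.lift_eq s _ _
  let ρ : W →ₐ[k] MvPolynomial σ k ⧸ I :=
    { lift.comp (val : W →+* Localization.Away s) with
      commutes' := fun c => by
        change lift (val (algebraMap k W c)) = _
        rw [val.commutes]
        exact lift_algebraMap (algebraMap k _ c) }
  have hρ (j : σ) : ρ (y j) = Ideal.Quotient.mk _ (X j) := by
    change lift (val (y j)) = _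
    have h1 : lift (IsLocalization.Away.invSelf s) = 1 := by
      have := congr(lift $(IsLocalization.Away.mul_invSelf (S := Localization.Away s) s))
      rw [map_mul, lift_algebraMap, hunit, one_mul, map_one] at this
      exact this
    rw [hval, map_mul, h1, one_mul, lift_algebraMap]
  obtain ⟨j, hj⟩ := exists_aeval_pderiv_ne_zero hf hf0 i y hy I rfl ρ hρ
    (fun j => (z i)⁻¹ * z j) (inv_mul_cancel₀ hi) (by rw [hf.aeval_mul_left, hfz, mul_zero])
  refine ⟨j, fun h => hj ?_⟩
  rw [(hf.pderiv).aeval_mul_left, h, mul_zero]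

end Jacobian

end

/-! ### Linear syzygies between coprime binary quadratic forms -/

section BinaryForms

open Polynomial

/-- If two polynomials without common root over an algebraically closed field, not both with
vanishing coefficient in degree two, satisfy a linear relation with linear coefficients,
then the relation is trivial. -/
theorem linear_relation_eq_zero {K : Type*} [Field K] [IsAlgClosed K] {l₁ l₂ q₁ q₂ : K[X]}
    (h₁ : l₁.natDegree ≤ 1) (h₂ : l₂.natDegree ≤ 1) (h : l₁ * q₁ + l₂ * q₂ = 0)
    (hroot : ∀ t, q₁.eval t = 0 → q₂.eval t ≠ 0)
    (hinf : q₁.coeff 2 = 0 → q₂.coeff 2 ≠ 0) : l₁ = 0 ∧ l₂ = 0 := by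
  have hcop : IsCoprime q₁ q₂ := by
    by_contra hc
    rw [Polynomial.isCoprime_iff_aeval_ne_zero_of_isAlgClosed (K := K) K] at hc
    push Not at hc
    obtain ⟨t, h1, h2⟩ := hc
    exact hroot t (by simpa using h1) (by simpa using h2)
  have coeff_two {q l : K[X]} (hl : l.natDegree ≤ 1) (hl0 : l ≠ 0) (hql : q ∣ l) :
      q.coeff 2 = 0 :=
    coeff_eq_zero_of_natDegree_lt ((natDegree_le_of_dvd hql hl0).trans hl |>.trans_lt one_lt_two)
  -- By coprimality each `q` divides the opposite `l`. A divisor of a nonzero linear polynomial has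
  -- no term of degree two, and `hinf` forbids this for both `q` at once.
  have d₂ : q₁ ∣ l₂ := hcop.dvd_of_dvd_mul_right ⟨-l₁, by linear_combination h⟩
  have d₁ : q₂ ∣ l₁ := hcop.symm.dvd_of_dvd_mul_right ⟨-l₂, by linear_combination h⟩
  have unit_coeff {q : K[X]} (hq : IsUnit q) : q.coeff 2 = 0 := by
    obtain ⟨c, -, rfl⟩ := Polynomial.isUnit_iff.mp hq
    simp
  by_contra hne
  by_cases h20 : l₂ = 0
  · have h10 : l₁ ≠ 0 := fun h' => hne ⟨h', h20⟩
    have hq : q₁ = 0 := by simpa [h20, h10] using h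
    subst hq
    exact hinf (by simp) (unit_coeff (isCoprime_zero_left.mp hcop))
  by_cases h10 : l₁ = 0
  · have hq : q₂ = 0 := by simpa [h20, h10] using h
    subst hq
    exact hinf (unit_coeff (isCoprime_zero_right.mp hcop)) (by simp)
  exact hinf (coeff_two h₂ h20 d₂) (coeff_two h₁ h10 d₁)

/-- The leading coefficient of a form along an affine line is its value in the direction. -/
theorem coeff_aeval_line {k : Type*} {σ : Type*} [CommRing k] {f : MvPolynomial σ k} {n : ℕ}
    (hf : f.IsHomogeneous n) {B : Type*} [CommRing B] [Algebra k B] (u w : σ → B) :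
    (MvPolynomial.aeval (fun i => C (u i) + X * C (w i)) f).coeff n =
      MvPolynomial.aeval w f := by
  have hdeg (a b : B) : (C a + X * C b).natDegree ≤ 1 := by compute_degree
  rw [MvPolynomial.aeval_def, MvPolynomial.eval₂_eq, MvPolynomial.aeval_def, MvPolynomial.eval₂_eq,
    finsetSum_coeff]
  refine Finset.sum_congr rfl fun d hd => ?_
  have hn : ∑ i ∈ d.support, d i = n := by
    rw [← Finsupp.degree_apply, Finsupp.degree_eq_weight_one]
    exact hf (MvPolynomial.mem_support_iff.mp hd)
  rw [IsScalarTower.algebraMap_apply k B B[X], algebraMap_eq, coeff_C_mul]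
  congr 1
  clear hd
  subst hn
  induction d.support using Finset.cons_induction with
  | empty => simp
  | cons i t hi ih =>
    -- The degree bounds of the factors add up to exactly the index in question, so the top
    -- coefficient is multiplicative.
    rw [Finset.prod_cons, Finset.sum_cons, Finset.prod_cons, coeff_mul_add_eq_of_natDegree_le, ih]
    · congr 1
      have := coeff_pow_of_natDegree_le (m := d i) (hdeg (u i) (w i))
      simpa using this
    · exact natDegree_pow_le_of_le _ (hdeg _ _) |>.trans (by simp)
    · refine (natDegree_prod_le _ _).trans (Finset.sum_le_sum fun j _ => ?_)
      exact natDegree_pow_le_of_le _ (hdeg _ _) |>.trans (by simp)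

end BinaryForms

/-! ### Polynomials vanishing on a line, and rigidity of lines -/

section LinesOnSurfaces

open MvPolynomial

variable {k L : Type*} [Field k] [Field L] [Algebra k L] {σ : Type*} [Fintype σ]

/-- The ideal generated by the linear forms that vanish at `u` and `w`. -/
noncomputable def linearIdeal (u w : σ → L) : Ideal (MvPolynomial σ L) :=
  Ideal.span {φ | ∃ c : σ → L, (∑ i, c i * u i = 0 ∧ ∑ i, c i * w i = 0) ∧
    φ = ∑ i, C (c i) * X i}

variable {u w : σ → L} {B : Type*} [CommRing B] [Algebra L B]

theorem aeval_eq_zero_of_mem_linearIdeal {p : MvPolynomial σ L} (hp : p ∈ linearIdeal u w)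
    (s t : B) :
    aeval (fun i => s * algebraMap L B (u i) + t * algebraMap L B (w i)) p = 0 := by
  suffices h : linearIdeal u w ≤ RingHom.ker
      (aeval (fun i => s * algebraMap L B (u i) + t * algebraMap L B (w i)) :
        MvPolynomial σ L →ₐ[L] B) from h hp
  refine Ideal.span_le.mpr ?_
  rintro _ ⟨c, ⟨hu, hw⟩, rfl⟩
  rw [SetLike.mem_coe, RingHom.mem_ker]
  have hu' := congr(algebraMap L B $hu)
  have hw' := congr(algebraMap L B $hw)
  simp only [map_sum, map_mul, map_zero, algHom_C, aeval_X] at hu' hw' ⊢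
  rw [← mul_zero s, ← hu', ← add_zero (s * _), ← mul_zero t, ← hw', Finset.mul_sum, Finset.mul_sum,
    ← Finset.sum_add_distrib]
  exact Finset.sum_congr rfl fun i _ => by ring

/-- A polynomial in the ideal of a linear subspace has vanishing derivative along the subspace. -/
theorem sum_mul_aeval_pderiv_eq_zero {p : MvPolynomial σ L} (hp : p ∈ linearIdeal u w) (s t : B)
    (e : σ → L) (he : ∀ c : σ → L, ∑ i, c i * u i = 0 → ∑ i, c i * w i = 0 → ∑ i, c i * e i = 0) :
    ∑ i, algebraMap L B (e i) *
      aeval (fun i => s * algebraMap L B (u i) + t * algebraMap L B (w i)) (pderiv i p) = 0 := by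
  classical
  set ev : MvPolynomial σ L →ₐ[L] B :=
    aeval (fun i => s * algebraMap L B (u i) + t * algebraMap L B (w i)) with hev
  induction hp using Submodule.span_induction with
  | mem x hx =>
    obtain ⟨c, ⟨hu, hw⟩, rfl⟩ := hx
    have h := congr(algebraMap L B $(he c hu hw))
    simp only [map_sum, map_mul, map_zero] at h
    rw [← h]
    refine Finset.sum_congr rfl fun i _ => ?_
    have : pderiv i (∑ j, C (c j) * X j : MvPolynomial σ L) = C (c i) := by
      simp [pderiv_X, Pi.single_apply]
    rw [this, algHom_C, mul_comm]
  | zero => simp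
  | add x y _ _ hx hy => simp only [map_add, mul_add, Finset.sum_add_distrib, hx, hy, add_zero]
  -- In the product rule the term containing the derivative of `a` drops out, because `x` vanishes
  -- on the subspace.
  | smul a x hx ih =>
    have h0 : ev x = 0 := aeval_eq_zero_of_mem_linearIdeal hx s t
    have h1 (i : σ) : algebraMap L B (e i) * ev (pderiv i (a • x)) =
        ev a * (algebraMap L B (e i) * ev (pderiv i x)) := by
      rw [smul_eq_mul, pderiv_mul, map_add, map_mul, map_mul, h0]
      ring
    simp only [h1, ← Finset.mul_sum, ih, mul_zero]

/-- A derivation applied to the coefficients of a polynomial. -/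
noncomputable def coeffDerivation (D : Derivation k L L) :
    Derivation k (Polynomial L) (Polynomial L) :=
  (PolynomialModule.equivPolynomialSelf (R := L)).toLinearMap.compDer D.mapCoeffs

theorem coeff_coeffDerivation (D : Derivation k L L) (p : Polynomial L) (n : ℕ) :
    (coeffDerivation D p).coeff n = D (p.coeff n) :=
  rfl

end LinesOnSurfaces

theorem sum_univ_four_perm {M : Type*} [AddCommMonoid M] (e : Equiv.Perm (Fin 4)) (g : Fin 4 → M) :
    ∑ i, g i = g (e 0) + g (e 1) + g (e 2) + g (e 3) := by
  rw [← Equiv.sum_comp e, Fin.sum_univ_four]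

/-- A line on a smooth cubic surface over `k` has no infinitesimal deformation over `k`. -/
theorem derivation_eq_zero_of_mem_linearIdeal {k L : Type*} [Field k] [Field L] [Algebra k L]
    {f : MvPolynomial (Fin 4) k} (hf : f.IsHomogeneous 3)
    (hns : ∀ z : Fin 4 → AlgebraicClosure L, z ≠ 0 → MvPolynomial.aeval z f = 0 →
      ∃ j, MvPolynomial.aeval z (MvPolynomial.pderiv j f) ≠ 0)
    (u w : Fin 4 → L) (e : Equiv.Perm (Fin 4))
    (hu0 : u (e 0) = 1) (hu1 : u (e 1) = 0) (hw0 : w (e 0) = 0) (hw1 : w (e 1) = 1)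
    (hfl : MvPolynomial.map (algebraMap k L) f ∈ linearIdeal u w)
    (D : Derivation k L L) : (∀ j, D (u j) = 0) ∧ (∀ j, D (w j) = 0) := by
  let K := AlgebraicClosure L
  -- no point of the line is a common zero of the two normal derivatives
  have key (s t : K) (hst : s ≠ 0 ∨ t ≠ 0) (z : Fin 4 → K)
      (hz : z = fun i => s * algebraMap L K (u i) + t * algebraMap L K (w i))
      (h2 : MvPolynomial.aeval z (MvPolynomial.pderiv (e 2) f) = 0) :
      MvPolynomial.aeval z (MvPolynomial.pderiv (e 3) f) ≠ 0 := by
    intro h3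
    have hz0 : z (e 0) = s := by simp [hz, hu0, hw0]
    have hz1 : z (e 1) = t := by simp [hz, hu1, hw1]
    have hne : z ≠ 0 := by
      rintro h0
      rw [h0] at hz0 hz1
      rcases hst with h | h
      · exact h hz0.symm
      · exact h hz1.symm
    have hfz : MvPolynomial.aeval z f = 0 := by
      have := aeval_eq_zero_of_mem_linearIdeal (B := K) hfl s t
      rwa [MvPolynomial.aeval_map_algebraMap, ← hz] at this
    have hd (v : Fin 4 → L) (hv) := sum_mul_aeval_pderiv_eq_zero (B := K) hfl s t v hv
    simp only [MvPolynomial.pderiv_map, MvPolynomial.aeval_map_algebraMap, ← hz, sum_univ_four_perm e, h2, h3,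
      mul_zero, add_zero] at hd
    -- The derivative along `u` is the `e 0` partial plus multiples of the `e 2` and `e 3` partials,
    -- which vanish here; likewise `w` handles `e 1`. So all four partials vanish.
    have d0 := hd u fun c hc _ => hc
    have d1 := hd w fun c _ hc => hc
    simp only [hu0, hu1, map_one, map_zero, one_mul, zero_mul, add_zero] at d0
    simp only [hw0, hw1, map_one, map_zero, one_mul, zero_mul, zero_add] at d1
    obtain ⟨j, hj⟩ := hns z hne hfz
    obtain ⟨i, rfl⟩ := e.surjective j
    fin_cases i
    · exact hj d0
    · exact hj d1
    · exact hj h2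
    · exact hj h3
  -- differentiate the equation along the line
  let v : Fin 4 → Polynomial L := fun i => .C (u i) + .X * .C (w i)
  let q : Fin 4 → Polynomial L := fun i => MvPolynomial.aeval v (MvPolynomial.pderiv (e i) f)
  let l : Fin 4 → Polynomial L := fun i => .C (D (u (e i))) + .X * .C (D (w (e i)))
  have hDv (i) : coeffDerivation D (v (e i)) = l i := by
    ext n
    rw [coeff_coeffDerivation]
    rcases n with _ | n
    · simp [v, l]
    · rcases n with _ | n <;> simp [v, l, Polynomial.coeff_C]
  have hfv : MvPolynomial.aeval v f = 0 := by
    have := aeval_eq_zero_of_mem_linearIdeal (B := Polynomial L) hfl 1 .X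
    simpa only [MvPolynomial.aeval_map_algebraMap, one_mul, Polynomial.algebraMap_eq] using this
  have hrel : l 2 * q 2 + l 3 * q 3 = 0 := by
    have h := (coeffDerivation D).map_mvPolynomial_aeval v f
    rw [hfv, map_zero, sum_univ_four_perm e, hDv, hDv, hDv, hDv] at h
    -- The normalized coordinates of `u` and `w` are 0 or 1, and `D` kills them, so only the two
    -- normal directions survive.
    have l0 : l 0 = 0 := by simp [l, hu0, hw0]
    have l1 : l 1 = 0 := by simp [l, hu1, hw1]
    rw [l0, l1, smul_zero, smul_zero, zero_add, zero_add, smul_eq_mul, smul_eq_mul] at h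
    rw [h, mul_comm, mul_comm (l 3)]
  let m : Polynomial L →ₐ[L] Polynomial K := Polynomial.mapAlg L K
  have hm (p) : m p = p.map (algebraMap L K) := rfl
  have hl (i) : (m (l i)).natDegree ≤ 1 :=
    Polynomial.natDegree_map_le.trans (by simp only [l]; compute_degree)
  have heval (t : K) (i) : (m (q i)).eval t = MvPolynomial.aeval
      (fun i => 1 * algebraMap L K (u i) + t * algebraMap L K (w i))
        (MvPolynomial.pderiv (e i) f) := by
    rw [hm, Polynomial.eval_map_algebraMap]
    change ((Polynomial.aeval t).restrictScalars k) _ = _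
    rw [MvPolynomial.comp_aeval_apply]
    congr 2
    funext i
    simp only [v, one_mul, map_add, map_mul, AlgHom.restrictScalars_apply, Polynomial.aeval_C,
      Polynomial.aeval_X]
  -- The coefficient of degree two is the value at the point `w`, the point at infinity of the
  -- parametrization.
  have hcoeff (i) : (m (q i)).coeff 2 = MvPolynomial.aeval
      (fun i => 0 * algebraMap L K (u i) + 1 * algebraMap L K (w i))
        (MvPolynomial.pderiv (e i) f) := by
    rw [hm, Polynomial.coeff_map, coeff_aeval_line hf.pderiv u w,
      ← MvPolynomial.aeval_algebraMap_apply]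
    congr 2
    funext i
    simp
  have hres := linear_relation_eq_zero (hl 2) (hl 3)
    (by rw [← map_mul, ← map_mul, ← map_add, hrel, map_zero])
    (fun t h2 => by
      rw [heval] at h2 ⊢
      exact key 1 t (.inl one_ne_zero) _ rfl h2)
    (fun h2 => by
      rw [hcoeff] at h2 ⊢
      exact key 0 1 (.inr one_ne_zero) _ rfl h2)
  have hminj : Function.Injective m := Polynomial.map_injective _ (algebraMap L K).injective
  have hl0 (i) : l i = 0 := by
    fin_cases i
    · simp [l, hu0, hw0]
    · simp [l, hu1, hw1]
    · exact hminj (hres.1.trans (map_zero m).symm)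
    · exact hminj (hres.2.trans (map_zero m).symm)
  constructor
  · intro j
    obtain ⟨i, rfl⟩ := e.surjective j
    simpa [l] using congr(Polynomial.coeff $(hl0 i) 0)
  · intro j
    obtain ⟨i, rfl⟩ := e.surjective j
    simpa [l] using congr(Polynomial.coeff $(hl0 i) 1)

noncomputable section

attribute [local instance] MvPolynomial.gradedAlgebra

/-! ### Separability through derivations -/

section Separability

/-- Linear functionals on the Kähler differentials are the derivations into `L`. Over a field
functionals separate points, so every differential vanishes and `L` is formally unramified over `k`.
-/
theorem isSeparable_of_forall_derivation_eq_zero {k L : Type u} [Field k] [Field L] [Algebra k L]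
    [Algebra.EssFiniteType k L] (h : ∀ (D : Derivation k L L) (x : L), D x = 0) :
    Algebra.IsSeparable k L := by
  rw [← Algebra.FormallyUnramified.iff_isSeparable]
  refine ⟨?_⟩
  have hd (x : L) : KaehlerDifferential.D k L x = 0 := by
    rw [← Module.forall_dual_apply_eq_zero_iff L]
    exact fun g => h (g.compDer (KaehlerDifferential.D k L)) x
  rw [← Submodule.subsingleton_iff L, ← subsingleton_iff_bot_eq_top, eq_comm, eq_bot_iff,
    ← KaehlerDifferential.span_range_derivation, Submodule.span_le]
  rintro _ ⟨x, rfl⟩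
  exact hd x

end Separability

/-! ### Residue fields of hypersurfaces as values of quotients of forms -/

section Fractions

open MvPolynomial

variable {k : Type u} [Field k] {σ : Type} {G : MvPolynomial σ k} {d : ℕ}
  (hG : G.IsHomogeneous d) (x : hypersurface G hG)

/-- The value at a point of the quotient of two forms of the same degree. -/
abbrev formRatio {F H : MvPolynomial σ k} {e : ℕ} (hF : F.IsHomogeneous e) (hH : H.IsHomogeneous e)
    (hx : x ∈ Proj.basicOpen (coordGrading G hG) (Ideal.Quotient.mk _ H)) :
    (hypersurface G hG).residueField x :=
  fractionAt (coordGrading G hG) x (mk_mem_quotientGrading _ hF) (mk_mem_quotientGrading _ hH) hx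

theorem exists_eq_formRatio (z : (hypersurface G hG).residueField x) :
    ∃ (e : ℕ) (F H : MvPolynomial σ k) (hF : F.IsHomogeneous e) (hH : H.IsHomogeneous e)
      (hx : x ∈ Proj.basicOpen (coordGrading G hG) (Ideal.Quotient.mk _ H)),
      z = formRatio hG x hF hH hx := by
  obtain ⟨s, rfl⟩ := (hypersurface G hG).residue_surjective x z
  obtain ⟨t, rfl⟩ : ∃ t, (Proj.stalkIso (coordGrading G hG) x).inv t = s :=
    ⟨(Proj.stalkIso (coordGrading G hG) x).hom s, by simp⟩
  obtain ⟨⟨e, ⟨_, F, hF, rfl⟩, ⟨_, H, hH, rfl⟩, hx⟩, rfl⟩ := HomogeneousLocalization.mk_surjective t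
  exact ⟨e, F, H, hF, hH, hx, rfl⟩

variable [Algebra k ((hypersurface G hG).residueField x)]
  {P : MvPolynomial σ k} (hP : P.IsHomogeneous 1)
  (hxP : x ∈ Proj.basicOpen (coordGrading G hG) (Ideal.Quotient.mk _ P))

/-- Forms of the same degree may be evaluated after normalizing by a linear form `P`. -/
theorem formRatio_mul_aeval
    (halg : algebraMap k ((hypersurface G hG).residueField x) =
      (evalAt (coordGrading G hG) x).comp ((HomogeneousLocalization.fromZeroRingHom
        (coordGrading G hG) _).comp (algebraMap k (coordGrading G hG 0))))
    {F H : MvPolynomial σ k} {e : ℕ} (hF : F.IsHomogeneous e)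
    (hH : H.IsHomogeneous e)
    (hx : x ∈ Proj.basicOpen (coordGrading G hG) (Ideal.Quotient.mk _ H)) :
    formRatio hG x hF hH hx * aeval (fun j => formRatio hG x (isHomogeneous_X k j) hP hxP) H =
      aeval (fun j => formRatio hG x (isHomogeneous_X k j) hP hxP) F ∧
    aeval (fun j => formRatio hG x (isHomogeneous_X k j) hP hxP) P = 1 := by
  let 𝔭 := x.asHomogeneousIdeal.toIdeal
  let W := HomogeneousLocalization.AtPrime (coordGrading G hG) 𝔭
  let _ : Algebra k W := ((HomogeneousLocalization.fromZeroRingHom (coordGrading G hG)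
    𝔭.primeCompl).comp (algebraMap k (coordGrading G hG 0))).toAlgebra
  let ev : W →ₐ[k] (hypersurface G hG).residueField x :=
    { evalAt (coordGrading G hG) x with
      commutes' := fun c => by rw [halg]; rfl }
  let val : W →ₐ[k] Localization.AtPrime 𝔭 :=
    { algebraMap W (Localization.AtPrime 𝔭) with
      commutes' := fun c => by
        change HomogeneousLocalization.val (HomogeneousLocalization.mk _) = _
        rw [HomogeneousLocalization.val_mk]
        exact Localization.mk_one_eq_algebraMap _ }
  -- Identities are checked in the full localization, where single forms of positive degree make
  -- sense and not only their degree-zero quotients.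
  have val_inj : Function.Injective val := HomogeneousLocalization.val_injective _
  let frac {F H : MvPolynomial σ k} {e : ℕ} (hF : F.IsHomogeneous e) (hH : H.IsHomogeneous e)
      (hx : x ∈ Proj.basicOpen (coordGrading G hG) (Ideal.Quotient.mk _ H)) : W :=
    HomogeneousLocalization.mk
      { deg := e
        num := ⟨_, mk_mem_quotientGrading _ hF⟩
        den := ⟨_, mk_mem_quotientGrading _ hH⟩
        den_mem := hx }
  let ι : MvPolynomial σ k →ₐ[k] Localization.AtPrime 𝔭 :=
    ((Algebra.ofId _ (Localization.AtPrime 𝔭)).restrictScalars k).comp 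
      (Ideal.Quotient.mkₐ k (principalIdeal G hG).toIdeal)
  have hval {F H : MvPolynomial σ k} {e : ℕ} (hF : F.IsHomogeneous e) (hH : H.IsHomogeneous e)
      (hx : x ∈ Proj.basicOpen (coordGrading G hG) (Ideal.Quotient.mk _ H)) :
      val (frac hF hH hx) * ι H = ι F := by
    change HomogeneousLocalization.val (HomogeneousLocalization.mk _) * _ = _
    rw [HomogeneousLocalization.val_mk, Localization.mk_eq_mk']
    exact IsLocalization.mk'_spec _ _ _
  obtain ⟨c, hc⟩ : ∃ c, c * ι P = 1 :=
    (IsLocalization.map_units (Localization.AtPrime 𝔭)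
      (⟨Ideal.Quotient.mk _ P, hxP⟩ : 𝔭.primeCompl)).exists_left_inv
  have hX (j : σ) : val (frac (isHomogeneous_X k j) hP hxP) = c * ι (X j) := by
    rw [← hval (isHomogeneous_X k j) hP hxP, mul_left_comm, hc, mul_one]
  -- Dividing all coordinates by `P` multiplies a form of degree `e` by the `e`-th power of `c`, the
  -- inverse of `P`.
  have hform {F : MvPolynomial σ k} {e : ℕ} (hF : F.IsHomogeneous e) :
      val (aeval (fun j => frac (isHomogeneous_X k j) hP hxP) F) = c ^ e * ι F := by
    rw [comp_aeval_apply]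
    simp only [hX]
    rw [hF.aeval_mul_left, ← comp_aeval_apply, aeval_X_left_apply]
  have hW : frac hF hH hx * aeval (fun j => frac (isHomogeneous_X k j) hP hxP) H =
      aeval (fun j => frac (isHomogeneous_X k j) hP hxP) F := by
    apply val_inj
    rw [map_mul, hform hH, hform hF, mul_left_comm, hval hF hH hx]
  have hWP : aeval (fun j => frac (isHomogeneous_X k j) hP hxP) P = 1 := by
    apply val_inj
    rw [hform hP, pow_one, hc, map_one]
  have h1 := congr(ev $hW)
  have h2 := congr(ev $hWP)
  rw [map_mul, comp_aeval_apply, comp_aeval_apply] at h1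
  rw [comp_aeval_apply, map_one] at h2
  exact ⟨h1, h2⟩

end Fractions

/-! ### Plücker relations -/

section Plucker

/-- By antisymmetry, each choice of indices gives either a trivial identity or the single Plücker
relation up to sign. -/
theorem plucker_identity {R : Type*} [CommRing R] (p : Fin 4 → Fin 4 → R) (h0 : ∀ i, p i i = 0)
    (ha : ∀ i j, p j i = -p i j) (hr : p 0 1 * p 2 3 - p 0 2 * p 1 3 + p 0 3 * p 1 2 = 0)
    (i j m b : Fin 4) : p i j * p m b - p i m * p j b + p j m * p i b = 0 := by
  have h10 := ha 0 1
  have h20 := ha 0 2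
  have h30 := ha 0 3
  have h21 := ha 1 2
  have h31 := ha 1 3
  have h32 := ha 2 3
  fin_cases i <;> fin_cases j <;> fin_cases m <;> fin_cases b <;>
    simp only [Fin.zero_eta, Fin.mk_one, Fin.reduceFinMk, h0, h10, h20, h30, h21, h31, h32] <;>
    first
    | ring1
    | linear_combination hr
    | linear_combination -hr

theorem exists_perm_fin_four (a b : Fin 4) (hab : a ≠ b) :
    ∃ e : Equiv.Perm (Fin 4), e 0 = a ∧ e 1 = b := by
  revert a b
  decide

end Plucker

open MvPolynomial

/-! ### Plücker coordinates of a line and generation of its field of definition -/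

namespace Line

variable {k : Type u} [Field k] (ℓ : Line k)

theorem algebraMap_fieldOfDefinition :
    algebraMap k ℓ.fieldOfDefinition =
      (evalAt (coordGrading (pluckerRelation k) (pluckerRelation_isHomogeneous k)) ℓ.point).comp
        ((HomogeneousLocalization.fromZeroRingHom
          (coordGrading (pluckerRelation k) (pluckerRelation_isHomogeneous k)) _).comp
        (algebraMap k (coordGrading (pluckerRelation k) (pluckerRelation_isHomogeneous k) 0))) :=
  congr(CommRingCat.Hom.hom $(toSpecZero_Γevaluation
    (coordGrading (pluckerRelation k) (pluckerRelation_isHomogeneous k)) ℓ.point))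

/-- The Plücker coordinates generate the coordinate ring over its degree-zero part, so their basic
opens cover. -/
theorem exists_inChart : ∃ a b, ℓ.InChart a b := by
  by_contra! h
  let J := (principalIdeal (pluckerRelation k) (pluckerRelation_isHomogeneous k)).toIdeal
  have htop := Proj.iSup_basicOpen_eq_top'
    (coordGrading (pluckerRelation k) (pluckerRelation_isHomogeneous k))
    (fun s : PluckerIndex => Ideal.Quotient.mk J (X s))
    (fun s => ⟨1, mk_mem_quotientGrading _ (isHomogeneous_X k s)⟩)
    (by
      rw [eq_top_iff]
      rintro z -
      obtain ⟨p, rfl⟩ := Ideal.Quotient.mk_surjective z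
      induction p using MvPolynomial.induction_on with
      | C a =>
        exact Subalgebra.algebraMap_mem _ (algebraMap k
          (coordGrading (pluckerRelation k) (pluckerRelation_isHomogeneous k) 0) a)
      | add p q hp hq => rw [map_add]; exact add_mem hp hq
      | mul_X p s hp =>
        rw [map_mul]
        exact mul_mem hp (Algebra.subset_adjoin ⟨s, rfl⟩))
  obtain ⟨⟨⟨a, b⟩, hab⟩, hs⟩ := TopologicalSpace.Opens.mem_iSup.mp
    (htop.ge (trivial : ℓ.point ∈ (⊤ : (Gr k).Opens)))
  refine h a b ?_
  rw [InChart, plucker, dif_pos hab]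
  exact hs

variable {ℓ} {a b : Fin 4} (h : ℓ.InChart a b)

/-- The evaluation of forms in the Plücker coordinates, normalized by `p a b = 1`. -/
def evalChart : MvPolynomial PluckerIndex k →ₐ[k] ℓ.fieldOfDefinition :=
  aeval fun s => formRatio (pluckerRelation_isHomogeneous k) ℓ.point (isHomogeneous_X k s)
    (plucker_isHomogeneous k a b) h

theorem formRatio_mul_evalChart {F H : MvPolynomial PluckerIndex k} {e : ℕ}
    (hF : F.IsHomogeneous e) (hH : H.IsHomogeneous e)
    (hx : ℓ.point ∈ Proj.basicOpen
      (coordGrading (pluckerRelation k) (pluckerRelation_isHomogeneous k))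
      (Ideal.Quotient.mk _ H)) :
    formRatio (pluckerRelation_isHomogeneous k) ℓ.point hF hH hx * evalChart h H =
      evalChart h F :=
  formRatio_mul_aeval _ _ (plucker_isHomogeneous k a b) h ℓ.algebraMap_fieldOfDefinition hF hH hx |>.1

theorem evalChart_plucker_self : evalChart h (plucker k a b) = 1 :=
  (formRatio_mul_aeval _ _ (plucker_isHomogeneous k a b) h ℓ.algebraMap_fieldOfDefinition
    (plucker_isHomogeneous k a b) (plucker_isHomogeneous k a b) h).2

theorem evalChart_ne_zero {H : MvPolynomial PluckerIndex k} {e : ℕ} (hH : H.IsHomogeneous e)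
    (hx : ℓ.point ∈ Proj.basicOpen
      (coordGrading (pluckerRelation k) (pluckerRelation_isHomogeneous k))
      (Ideal.Quotient.mk _ H)) : evalChart h H ≠ 0 := by
  intro h0
  -- The quotient of this power by `H` is an inverse of the value of `H`, since the power takes the
  -- value 1.
  have hF : (plucker k a b ^ e).IsHomogeneous e := by
    simpa using (plucker_isHomogeneous k a b).pow e
  have h1 := formRatio_mul_evalChart h hF hH hx
  rw [h0, mul_zero, map_pow, evalChart_plucker_self, one_pow] at h1
  exact zero_ne_one h1

theorem ratio_eq_evalChart (i j : Fin 4) : ℓ.ratio h i j = evalChart h (plucker k i j) := by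
  have h1 := formRatio_mul_evalChart h (plucker_isHomogeneous k i j) (plucker_isHomogeneous k a b) h
  rwa [evalChart_plucker_self, mul_one] at h1

theorem ratio_mul_ratio {a' b' : Fin 4} (h' : ℓ.InChart a' b') (i j : Fin 4) :
    ℓ.ratio h' i j * ℓ.ratio h a' b' = ℓ.ratio h i j := by
  rw [ratio_eq_evalChart h, ratio_eq_evalChart h]
  exact formRatio_mul_evalChart h (plucker_isHomogeneous k i j) (plucker_isHomogeneous k a' b') h'

theorem ratio_self : ℓ.ratio h a b = 1 := by
  rw [ratio_eq_evalChart, evalChart_plucker_self]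

theorem ratio_ne_zero {a' b' : Fin 4} (h' : ℓ.InChart a' b') : ℓ.ratio h a' b' ≠ 0 := by
  rw [ratio_eq_evalChart h]
  exact evalChart_ne_zero h (plucker_isHomogeneous k a' b') h'

theorem ratio_diag (i : Fin 4) : ℓ.ratio h i i = 0 := by
  rw [ratio_eq_evalChart h, plucker, dif_neg (lt_irrefl i), dif_neg (lt_irrefl i), map_zero]

theorem ratio_swap (i j : Fin 4) : ℓ.ratio h j i = -ℓ.ratio h i j := by
  rw [ratio_eq_evalChart h, ratio_eq_evalChart h, ← map_neg]
  congr 1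
  unfold plucker
  rcases lt_trichotomy i j with hij | rfl | hij
  · simp [hij, hij.asymm]
  · simp
  · simp [hij, hij.asymm]

theorem ratio_plucker (i j m n : Fin 4) :
    ℓ.ratio h i j * ℓ.ratio h m n - ℓ.ratio h i m * ℓ.ratio h j n
      + ℓ.ratio h j m * ℓ.ratio h i n = 0 := by
  refine plucker_identity (ℓ.ratio h) (ratio_diag h) (ratio_swap h) ?_ i j m n
  simp only [ratio_eq_evalChart h, ← map_mul, ← map_sub, ← map_add]
  change evalChart h (pluckerRelation k) = 0
  have hx : ℓ.point ∈ Proj.basicOpen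
      (coordGrading (pluckerRelation k) (pluckerRelation_isHomogeneous k))
      (Ideal.Quotient.mk _ (plucker k a b ^ 2)) := by
    rw [map_pow, Proj.basicOpen_pow _ _ _ two_pos]
    exact h
  rw [← formRatio_mul_evalChart h (pluckerRelation_isHomogeneous k)
    (by simpa using (plucker_isHomogeneous k a b).pow 2) hx]
  -- The Plücker relation divided by the square of `plucker k a b` has numerator zero in the
  -- coordinate ring.
  refine mul_eq_zero_of_left (Eq.trans (congrArg _ ?_) (map_zero (evalAt _ _))) _
  exact HomogeneousLocalization.mk_eq_zero_of_num _
    (Subtype.ext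
      (Ideal.Quotient.eq_zero_iff_mem.mpr (Ideal.mem_span_singleton_self (pluckerRelation k))))

/-- One chart suffices: the ratios in any two charts differ by a nonzero common factor. -/
theorem mem_subspace_of_forall {v : Fin 4 → ℓ.fieldOfDefinition}
    (hv : ∀ i j m, ℓ.ratio h i j * v m - ℓ.ratio h i m * v j + ℓ.ratio h j m * v i = 0) :
    v ∈ ℓ.subspace := by
  intro a' b' h' i j m
  refine (mul_eq_zero_iff_right (ratio_ne_zero h h')).mp ?_
  have := hv i j m
  rw [← ratio_mul_ratio h h' i j, ← ratio_mul_ratio h h' i m, ← ratio_mul_ratio h h' j m] at this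
  linear_combination this

/-- Contracting the decomposable bivector of the line with a coordinate functional gives a vector of
the line; this supplies explicit points of it. -/
theorem ratio_left_mem_subspace (n : Fin 4) : (fun m => ℓ.ratio h m n) ∈ ℓ.subspace :=
  mem_subspace_of_forall h fun i j m => ratio_plucker h i j m n

theorem ratio_right_mem_subspace (n : Fin 4) : (fun m => ℓ.ratio h n m) ∈ ℓ.subspace := by
  convert! ℓ.subspace.neg_mem (ratio_left_mem_subspace h n) using 1
  funext m
  exact ratio_swap h m n

/-- Only membership of `u` and `w` in the subspace matters; that they span it is never required. -/
theorem ideal_le_linearIdeal {u w : Fin 4 → ℓ.fieldOfDefinition} (hu : u ∈ ℓ.subspace)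
    (hw : w ∈ ℓ.subspace) : ℓ.ideal ≤ linearIdeal u w := by
  refine Ideal.span_mono ?_
  rintro φ ⟨c, hc, rfl⟩
  exact ⟨c, ⟨hc u hu, hc w hw⟩, rfl⟩

theorem exists_eq_evalChart_div (z : ℓ.fieldOfDefinition) :
    ∃ F H : MvPolynomial PluckerIndex k, evalChart h H ≠ 0 ∧
      z = evalChart h F / evalChart h H := by
  obtain ⟨e, F, H, hF, hH, hx, rfl⟩ :=
    exists_eq_formRatio (pluckerRelation_isHomogeneous k) ℓ.point z
  have hne := evalChart_ne_zero h hH hx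
  exact ⟨F, H, hne, (eq_div_iff hne).mpr (formRatio_mul_evalChart h hF hH hx)⟩

theorem evalChart_eq_aeval :
    evalChart h = aeval fun s : PluckerIndex => ℓ.ratio h s.1.1 s.1.2 := by
  refine MvPolynomial.algHom_ext fun s => ?_
  rw [aeval_X, ratio_eq_evalChart h, plucker, dif_pos s.2]

include h in
-- The six ratios generate the field, because each element is a quotient of polynomials in them.
theorem essFiniteType : Algebra.EssFiniteType k ℓ.fieldOfDefinition := by
  rw [← IntermediateField.fg_top_iff]
  refine ⟨Set.Finite.toFinset (Set.finite_range fun s : PluckerIndex => ℓ.ratio h s.1.1 s.1.2), ?_⟩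
  rw [Set.Finite.coe_toFinset, eq_top_iff]
  rintro z -
  have hmem (F : MvPolynomial PluckerIndex k) : evalChart h F ∈ IntermediateField.adjoin k
      (Set.range fun s : PluckerIndex => ℓ.ratio h s.1.1 s.1.2) := by
    apply IntermediateField.algebra_adjoin_le_adjoin
    rw [evalChart_eq_aeval, Algebra.adjoin_range_eq_range_aeval]
    exact ⟨F, rfl⟩
  obtain ⟨F, H, -, rfl⟩ := exists_eq_evalChart_div h z
  exact div_mem (hmem F) (hmem H)

theorem derivation_eq_zero (D : Derivation k ℓ.fieldOfDefinition ℓ.fieldOfDefinition)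
    (hD : ∀ i j, D (ℓ.ratio h i j) = 0) (z : ℓ.fieldOfDefinition) : D z = 0 := by
  have heval (F : MvPolynomial PluckerIndex k) : D (evalChart h F) = 0 := by
    rw [evalChart_eq_aeval, D.map_mvPolynomial_aeval]
    exact Finset.sum_eq_zero fun s _ => by rw [hD, smul_zero]
  obtain ⟨F, H, hne, rfl⟩ := exists_eq_evalChart_div h z
  have h1 : D (evalChart h F / evalChart h H * evalChart h H) = 0 := by
    rw [div_mul_cancel₀ _ hne, heval]
  rw [D.leibniz, heval, smul_zero, zero_add, smul_eq_mul] at h1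
  exact (mul_eq_zero.mp h1).resolve_left hne

end Line

end

end CubicLines

theorem mainTheorem8 {k : Type u} [Field k] (f : MvPolynomial (Fin 4) k)
    (hf : f.IsHomogeneous 3) (hf0 : f ≠ 0)
    (hsmooth : Smooth (CubicLines.hypersurfaceToSpec f hf))
    (ℓ : CubicLines.Line k) (hℓ : ℓ.IsContainedIn f) :
    Algebra.IsSeparable k ℓ.fieldOfDefinition := by
  obtain ⟨a, b, h⟩ := ℓ.exists_inChart
  have := CubicLines.Line.essFiniteType h
  refine CubicLines.isSeparable_of_forall_derivation_eq_zero fun D z =>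
    CubicLines.Line.derivation_eq_zero h D (fun i j => ?_) z
  have hab : a ≠ b := by
    rintro rfl
    exact one_ne_zero ((CubicLines.Line.ratio_self h).symm.trans (CubicLines.Line.ratio_diag h a))
  obtain ⟨e, rfl, rfl⟩ := CubicLines.exists_perm_fin_four a b hab
  -- The column and the row through the entry `p (e 0) (e 1) = 1` give two vectors of the line, and
  -- the zero diagonal makes their `e 0`, `e 1` coordinates an identity matrix.
  obtain ⟨hu, hw⟩ := CubicLines.derivation_eq_zero_of_mem_linearIdeal hf
    (fun z hz hfz => CubicLines.exists_aeval_pderiv_ne_zero_of_smooth hf hf0 hsmooth z hz hfz)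
    (fun m => ℓ.ratio h m (e 1)) (fun m => ℓ.ratio h (e 0) m) e
    (CubicLines.Line.ratio_self h) (CubicLines.Line.ratio_diag h _)
    (CubicLines.Line.ratio_diag h _) (CubicLines.Line.ratio_self h)
    (CubicLines.Line.ideal_le_linearIdeal (CubicLines.Line.ratio_left_mem_subspace h _)
      (CubicLines.Line.ratio_right_mem_subspace h _) hℓ) D
  -- With this normalization the Plücker relation expresses each ratio as the minor `u i * w j - u j
  -- * w i`, so `D` kills it.
  have hrel := CubicLines.Line.ratio_plucker h i j (e 0) (e 1)
  rw [CubicLines.Line.ratio_self, mul_one, CubicLines.Line.ratio_swap h (e 0) i,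
    CubicLines.Line.ratio_swap h (e 0) j] at hrel
  have hij : ℓ.ratio h i j = ℓ.ratio h (e 0) j * ℓ.ratio h i (e 1) -
      ℓ.ratio h (e 0) i * ℓ.ratio h j (e 1) := by
    linear_combination hrel
  rw [hij, map_sub, D.leibniz, D.leibniz, hu, hu, hw, hw]
  simp
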